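/- Let $G$ be a finite simple graph with at least one edge, let $A_G$ be its adjacency matrix, with eigenvalues $\lambda_1\ge\cdots\ge\lambda_n$, and for real $p$ put $$\mathcal E_p^+(G)=\sum_{\lambda_i>0}\lambda_i^p,\qquad \mathcal E_p^-(G)=\sum_{\lambda_i<0}|\lambda_i|^p .$$ Let $\chi(G)$ be the chromatic number of $G$, and let the projective rank $\xi_f(G)$ be the infimum of $d/r$ over all pairs of positive integers $d,r$ for which there are rank-$r$ orthogonal projectors $P_v\in\mathbb C^{d\times d}$ $(v\in V(G))$ with $P_vP_w=0$ for all edges $vw$ of $G$. Then $\lambda_1>0>\lambda_n$, $\mathcal E_p^\pm(G)>0$ for all real $p$, and: 1. As $p\to\infty$, $$1+\left(\frac{\mathcal E_p^+(G)}{\mathcal E_p^-(G)}\right)^{\frac1{p-1}}\longrightarrow 1+\frac{\lambda_1}{-\lambda_n} \quad\text{and}\quad 1+\max\left\{\frac{\mathcal E_p^+(G)}{\mathcal E_p^-(G)},\frac{\mathcal E_p^-(G)}{\mathcal E_p^+(G)}\right\}^{\frac1{|p-1|}}\longrightarrow 1+\frac{\lambda_1}{-\lambda_n}.$$ 2. Consequently,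 every real number $x$ (for instance $x=\xi_f(G)$ or $x=\chi(G)$) that satisfies $$x\ge 1+\max\left\{\frac{\mathcal E_p^+(G)}{\mathcal E_p^-(G)},\frac{\mathcal E_p^-(G)}{\mathcal E_p^+(G)}\right\}^{\frac1{|p-1|}}$$ for arbitrarily large $p$ also satisfies $x\ge 1+\frac{\lambda_1}{-\lambda_n}$. 3. The Hoffman bound holds, for the projective rank and hence for the chromatic number: $$\chi(G)\ \ge\ \xi_f(G)\ \ge\ 1+\frac{\lambda_1}{-\lambda_n}.$$ -/

import Mathlib

open Filter Topology

namespace SimpleGraph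

noncomputable section

/-- The eigenvalues (with multiplicity) of the real adjacency matrix of a finite simple graph. -/
def adjEigenvalues {V : Type*} [Fintype V] [DecidableEq V] (G : SimpleGraph V)
    [DecidableRel G.Adj] : V → ℝ :=
  (G.isHermitian_adjMatrix ℝ).eigenvalues

/-- The largest adjacency eigenvalue `λ₁`. -/
def maxAdjEigenvalue {V : Type*} [Fintype V] [DecidableEq V] (G : SimpleGraph V)
    [DecidableRel G.Adj] : ℝ :=
  ⨆ i, G.adjEigenvalues i

/-- The smallest adjacency eigenvalue `λₙ`. -/
def minAdjEigenvalue {V : Type*} [Fintype V] [DecidableEq V] (G : SimpleGraph V)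
    [DecidableRel G.Adj] : ℝ :=
  ⨅ i, G.adjEigenvalues i

/-- The positive `p`-energy: the sum of `λ ^ p` over the positive eigenvalues. -/
def posEnergy {V : Type*} [Fintype V] [DecidableEq V] (G : SimpleGraph V)
    [DecidableRel G.Adj] (p : ℝ) : ℝ :=
  ∑ i with 0 < G.adjEigenvalues i, G.adjEigenvalues i ^ p

/-- The negative `p`-energy: the sum of `|λ| ^ p` over the negative eigenvalues. -/
def negEnergy {V : Type*} [Fintype V] [DecidableEq V] (G : SimpleGraph V)
    [DecidableRel G.Adj] (p : ℝ) : ℝ :=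
  ∑ i with G.adjEigenvalues i < 0, |G.adjEigenvalues i| ^ p

/-- The lower bound `1 + max {E⁺ₚ / E⁻ₚ, E⁻ₚ / E⁺ₚ} ^ (1 / |p - 1|)`. -/
def energyBound {V : Type*} [Fintype V] [DecidableEq V] (G : SimpleGraph V)
    [DecidableRel G.Adj] (p : ℝ) : ℝ :=
  1 + (max (G.posEnergy p / G.negEnergy p) (G.negEnergy p / G.posEnergy p)) ^ (1 / |p - 1|)

/-- `G` has a `d/r`-representation: an assignment of rank-`r` orthogonal projectors in `ℂ^(d × d)`
to the vertices such that the projectors of adjacent vertices have product zero. -/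
def HasProjRep {V : Type*} (G : SimpleGraph V) (d r : ℕ) : Prop :=
  ∃ P : V → Matrix (Fin d) (Fin d) ℂ,
    (∀ v, IsStarProjection (P v) ∧ (P v).rank = r) ∧ ∀ v w, G.Adj v w → P v * P w = 0

/-- The projective rank `ξ_f(G)`: the infimum of `d / r` over all `d/r`-representations. -/
def projectiveRank {V : Type*} (G : SimpleGraph V) : ℝ :=
  sInf {x : ℝ | ∃ d r : ℕ, 0 < d ∧ 0 < r ∧ G.HasProjRep d r ∧ x = (d : ℝ) / (r : ℝ)}

end

end SimpleGraph

/-! Write n for the number of vertices and ρ = λ₁/(-λₙ). For p ≥ 0 the positive energy lies between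
λ₁^p and n λ₁^p, and the negative energy between (-λₙ)^p and n (-λₙ)^p. Their ratio is thus ρ^p up
to a factor n, which the (p-1)-th root removes in the limit. Since -λₙ ≤ λ₁, the inverse ratio obeys
the same upper bound, so the maximum has the same limit.

The bound for the projective rank is proved directly, without energies. The Rayleigh bound for λₙ
holds for matrix-valued vectors too (`min_mul_sum_le_trace`). It is tested on Y_v = x_v (P_v - (r/d)
I), with x a unit eigenvector for λ₁: orthogonality along edges turns the edge sum into -(r²/d) λ₁,
while the squared norms sum to r - r²/d. Rearranging gives d/r ≥ 1 + ρ. Colourings are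
representations with r = 1. -/

open Matrix in
/-- A quadratic form of a real Hermitian matrix in terms of its eigenvalues and eigenvectors. -/
theorem Matrix.IsHermitian.dotProduct_mulVec_eq_sum {V : Type*} [Fintype V] [DecidableEq V]
    {A : Matrix V V ℝ} (hA : A.IsHermitian) (x : V → ℝ) :
    x ⬝ᵥ A *ᵥ x = ∑ i, hA.eigenvalues i * (x ⬝ᵥ ⇑(hA.eigenvectorBasis i)) ^ 2 := by
  have h := hA.eigenvectorBasis.sum_inner_mul_inner (WithLp.toLp 2 x) (WithLp.toLp 2 (A *ᵥ x))
  simp only [EuclideanSpace.inner_eq_star_dotProduct, star_trivial] at h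
  rw [dotProduct_comm, ← h]
  refine Finset.sum_congr rfl fun i _ => ?_
  have h2 : (A *ᵥ x) ⬝ᵥ ⇑(hA.eigenvectorBasis i) =
      hA.eigenvalues i * (x ⬝ᵥ ⇑(hA.eigenvectorBasis i)) := by
    have hT : Aᵀ = A := by simpa [conjTranspose_eq_transpose_of_trivial] using hA.eq
    rw [dotProduct_comm, dotProduct_mulVec, ← mulVec_transpose, hT, hA.mulVec_eigenvectorBasis,
      smul_dotProduct, dotProduct_comm, smul_eq_mul]
  rw [h2, dotProduct_comm]
  ring

open Matrix in
theorem Matrix.IsHermitian.dotProduct_self_eq_sum {V : Type*} [Fintype V] [DecidableEq V]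
    {A : Matrix V V ℝ} (hA : A.IsHermitian) (x : V → ℝ) :
    x ⬝ᵥ x = ∑ i, (x ⬝ᵥ ⇑(hA.eigenvectorBasis i)) ^ 2 := by
  have h := hA.eigenvectorBasis.sum_inner_mul_inner (WithLp.toLp 2 x) (WithLp.toLp 2 x)
  simp only [EuclideanSpace.inner_eq_star_dotProduct, star_trivial] at h
  rw [← h]
  refine Finset.sum_congr rfl fun i _ => ?_
  rw [dotProduct_comm (hA.eigenvectorBasis i).ofLp, sq]

/-- The rank of an idempotent matrix is its trace. -/
theorem Matrix.trace_eq_rank_of_isIdempotentElem {n K : Type*} [Fintype n] [DecidableEq n]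
    [Field K] {P : Matrix n n K} (hP : IsIdempotentElem P) : P.trace = P.rank := by
  have h : IsIdempotentElem (Matrix.toLin' P) := by
    rw [IsIdempotentElem, Module.End.mul_eq_comp, ← Matrix.toLin'_mul, hP.eq]
  rw [← Matrix.trace_toLin'_eq, (LinearMap.IsIdempotentElem.isProj_range _ h).trace]
  rfl

namespace SimpleGraph

variable {V : Type*} [Fintype V] [DecidableEq V] (G : SimpleGraph V) [DecidableRel G.Adj]

theorem adjEigenvalues_le_max (i : V) : G.adjEigenvalues i ≤ G.maxAdjEigenvalue :=
  le_ciSup (Set.finite_range _).bddAbove i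

theorem min_le_adjEigenvalues (i : V) : G.minAdjEigenvalue ≤ G.adjEigenvalues i :=
  ciInf_le (Set.finite_range _).bddBelow i

theorem exists_adjEigenvalues_eq_max [Nonempty V] :
    ∃ i, G.adjEigenvalues i = G.maxAdjEigenvalue :=
  exists_eq_ciSup_of_finite

theorem exists_adjEigenvalues_eq_min [Nonempty V] :
    ∃ i, G.adjEigenvalues i = G.minAdjEigenvalue :=
  exists_eq_ciInf_of_finite

/-! ### Rayleigh bounds and the signs of the extreme eigenvalues -/

/-- The quadratic form of the adjacency matrix, as a double sum over the vertices. -/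
def adjForm {V : Type*} [Fintype V] (G : SimpleGraph V) [DecidableRel G.Adj]
    (x : V → ℝ) : ℝ := ∑ v, ∑ w, if G.Adj v w then x v * x w else 0

theorem adjForm_eq_dotProduct {V : Type*} [Fintype V] (G : SimpleGraph V) [DecidableRel G.Adj]
    (x : V → ℝ) :
    G.adjForm x = x ⬝ᵥ (G.adjMatrix ℝ).mulVec x := by
  simp [adjForm, dotProduct, Matrix.mulVec, Finset.mul_sum, adjMatrix_apply]

theorem adjForm_le (x : V → ℝ) : G.adjForm x ≤ G.maxAdjEigenvalue * ∑ v, x v ^ 2 := by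
  have h : ∑ v, x v ^ 2 = x ⬝ᵥ x := by simp [dotProduct, sq]
  rw [h, adjForm_eq_dotProduct, (G.isHermitian_adjMatrix ℝ).dotProduct_mulVec_eq_sum,
    (G.isHermitian_adjMatrix ℝ).dotProduct_self_eq_sum, Finset.mul_sum]
  exact Finset.sum_le_sum fun i _ =>
    mul_le_mul_of_nonneg_right (G.adjEigenvalues_le_max i) (sq_nonneg _)

theorem le_adjForm (x : V → ℝ) : G.minAdjEigenvalue * ∑ v, x v ^ 2 ≤ G.adjForm x := by
  have h : ∑ v, x v ^ 2 = x ⬝ᵥ x := by simp [dotProduct, sq]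
  rw [h, adjForm_eq_dotProduct, (G.isHermitian_adjMatrix ℝ).dotProduct_mulVec_eq_sum,
    (G.isHermitian_adjMatrix ℝ).dotProduct_self_eq_sum, Finset.mul_sum]
  exact Finset.sum_le_sum fun i _ =>
    mul_le_mul_of_nonneg_right (G.min_le_adjEigenvalues i) (sq_nonneg _)

theorem exists_adjForm_eq (i : V) :
    ∃ x : V → ℝ, ∑ v, x v ^ 2 = 1 ∧ G.adjForm x = G.adjEigenvalues i := by
  have hA := G.isHermitian_adjMatrix ℝ
  have h1 : ∑ v, (hA.eigenvectorBasis i) v ^ 2 = 1 := by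
    have h := hA.eigenvectorBasis.orthonormal.1 i
    rw [EuclideanSpace.norm_eq, Real.sqrt_eq_one] at h
    simpa using h
  refine ⟨hA.eigenvectorBasis i, h1, ?_⟩
  rw [adjForm_eq_dotProduct, hA.mulVec_eigenvectorBasis, dotProduct_smul]
  have h : (hA.eigenvectorBasis i).ofLp ⬝ᵥ (hA.eigenvectorBasis i).ofLp = 1 := by
    rw [← h1]; simp [dotProduct, sq]
  rw [h, smul_eq_mul, mul_one]
  rfl

/-- The entries of the adjacency matrix are nonnegative. Evaluated at a unit eigenvector for λₙ,
this gives -λₙ ≤ λ₁. -/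
theorem adjForm_neg_le_adjForm_abs {V : Type*} [Fintype V] (G : SimpleGraph V)
    [DecidableRel G.Adj] (x : V → ℝ) : -G.adjForm x ≤ G.adjForm fun v => |x v| := by
  simp only [adjForm, ← Finset.sum_neg_distrib]
  refine Finset.sum_le_sum fun v _ => Finset.sum_le_sum fun w _ => ?_
  split_ifs
  · rw [← abs_mul]; exact neg_le_abs _
  · simp

theorem neg_minAdjEigenvalue_le_max [Nonempty V] :
    -G.minAdjEigenvalue ≤ G.maxAdjEigenvalue := by
  obtain ⟨i, hi⟩ := G.exists_adjEigenvalues_eq_min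
  obtain ⟨x, hx, hxi⟩ := G.exists_adjForm_eq i
  have h := (G.adjForm_neg_le_adjForm_abs x).trans (G.adjForm_le _)
  simpa [hx, hxi, hi] using h

/-- The trace is zero, so nonnegative eigenvalues would all vanish, and with them the matrix. -/
theorem minAdjEigenvalue_neg (hG : G ≠ ⊥) : G.minAdjEigenvalue < 0 := by
  by_contra! h0
  have hA := G.isHermitian_adjMatrix ℝ
  have hnn (i : V) : 0 ≤ hA.eigenvalues i := h0.trans (G.min_le_adjEigenvalues i)
  have ht := hA.trace_eq_sum_eigenvalues
  rw [trace_adjMatrix] at ht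
  have hz : hA.eigenvalues = 0 := by
    funext i
    exact (Finset.sum_eq_zero_iff_of_nonneg fun i _ => hnn i).1 (by simpa using ht.symm) i
      (Finset.mem_univ i)
  rw [hA.eigenvalues_eq_zero_iff] at hz
  refine hG (eq_bot_iff.2 fun v w hvw => ?_)
  have := congrFun (congrFun hz v) w
  simp [adjMatrix_apply, hvw] at this

theorem nonempty_of_ne_bot {V : Type*} {G : SimpleGraph V} (hG : G ≠ ⊥) : Nonempty V := by
  by_contra h
  rw [not_nonempty_iff] at h
  exact hG (Subsingleton.elim _ _)

theorem maxAdjEigenvalue_pos (hG : G ≠ ⊥) : 0 < G.maxAdjEigenvalue := by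
  have := nonempty_of_ne_bot hG
  linarith [G.neg_minAdjEigenvalue_le_max, G.minAdjEigenvalue_neg hG]

/-! ### Two-sided estimates of the energies -/

theorem rpow_max_le_posEnergy (hG : G ≠ ⊥) (p : ℝ) :
    G.maxAdjEigenvalue ^ p ≤ G.posEnergy p := by
  have := nonempty_of_ne_bot hG
  obtain ⟨i, hi⟩ := G.exists_adjEigenvalues_eq_max
  rw [← hi]
  refine Finset.single_le_sum (f := fun i => G.adjEigenvalues i ^ p) (fun j hj => ?_) ?_
  · exact Real.rpow_nonneg (Finset.mem_filter.1 hj).2.le p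
  · simpa [hi] using G.maxAdjEigenvalue_pos hG

theorem rpow_neg_min_le_negEnergy (hG : G ≠ ⊥) (p : ℝ) :
    (-G.minAdjEigenvalue) ^ p ≤ G.negEnergy p := by
  have := nonempty_of_ne_bot hG
  obtain ⟨i, hi⟩ := G.exists_adjEigenvalues_eq_min
  rw [← abs_of_neg (G.minAdjEigenvalue_neg hG), ← hi]
  refine Finset.single_le_sum (f := fun i => |G.adjEigenvalues i| ^ p) (fun j _ => ?_) ?_
  · exact Real.rpow_nonneg (abs_nonneg _) p
  · simpa [hi] using G.minAdjEigenvalue_neg hG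

theorem posEnergy_pos (hG : G ≠ ⊥) (p : ℝ) : 0 < G.posEnergy p :=
  (Real.rpow_pos_of_pos (G.maxAdjEigenvalue_pos hG) p).trans_le (G.rpow_max_le_posEnergy hG p)

theorem negEnergy_pos (hG : G ≠ ⊥) (p : ℝ) : 0 < G.negEnergy p :=
  (Real.rpow_pos_of_pos (neg_pos.2 (G.minAdjEigenvalue_neg hG)) p).trans_le
    (G.rpow_neg_min_le_negEnergy hG p)

theorem posEnergy_le (hG : G ≠ ⊥) {p : ℝ} (hp : 0 ≤ p) :
    G.posEnergy p ≤ Fintype.card V * G.maxAdjEigenvalue ^ p := by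
  refine (Finset.sum_le_card_nsmul _ _ (G.maxAdjEigenvalue ^ p) fun i hi => ?_).trans ?_
  · exact Real.rpow_le_rpow (Finset.mem_filter.1 hi).2.le (G.adjEigenvalues_le_max i) hp
  · rw [nsmul_eq_mul]
    exact mul_le_mul_of_nonneg_right (mod_cast Finset.card_le_univ _)
      (Real.rpow_nonneg (G.maxAdjEigenvalue_pos hG).le p)

theorem negEnergy_le (hG : G ≠ ⊥) {p : ℝ} (hp : 0 ≤ p) :
    G.negEnergy p ≤ Fintype.card V * (-G.minAdjEigenvalue) ^ p := by
  refine (Finset.sum_le_card_nsmul _ _ ((-G.minAdjEigenvalue) ^ p) fun i hi => ?_).trans ?_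
  · rw [abs_of_neg (Finset.mem_filter.1 hi).2]
    exact Real.rpow_le_rpow (neg_pos.2 (Finset.mem_filter.1 hi).2).le
      (neg_le_neg (G.min_le_adjEigenvalues i)) hp
  · rw [nsmul_eq_mul]
    exact mul_le_mul_of_nonneg_right (mod_cast Finset.card_le_univ _)
      (Real.rpow_nonneg (neg_pos.2 (G.minAdjEigenvalue_neg hG)).le p)

theorem posEnergy_div_negEnergy_le (hG : G ≠ ⊥) {p : ℝ} (hp : 0 ≤ p) :
    G.posEnergy p / G.negEnergy p ≤
      Fintype.card V * (G.maxAdjEigenvalue / -G.minAdjEigenvalue) ^ p := by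
  have h1 := G.maxAdjEigenvalue_pos hG
  have h2 := neg_pos.2 (G.minAdjEigenvalue_neg hG)
  rw [Real.div_rpow h1.le h2.le, ← mul_div_assoc]
  exact div_le_div₀ (by positivity) (G.posEnergy_le hG hp) (by positivity)
    (G.rpow_neg_min_le_negEnergy hG p)

theorem le_posEnergy_div_negEnergy (hG : G ≠ ⊥) {p : ℝ} (hp : 0 ≤ p) :
    (Fintype.card V : ℝ)⁻¹ * (G.maxAdjEigenvalue / -G.minAdjEigenvalue) ^ p ≤
      G.posEnergy p / G.negEnergy p := by
  have h1 := G.maxAdjEigenvalue_pos hG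
  have h2 := neg_pos.2 (G.minAdjEigenvalue_neg hG)
  have h3 := G.negEnergy_le hG hp
  rw [Real.div_rpow h1.le h2.le, inv_mul_eq_div, div_div, mul_comm (_ ^ p) (Fintype.card V : ℝ)]
  exact div_le_div₀ (G.posEnergy_pos hG p).le (G.rpow_max_le_posEnergy hG p) (G.negEnergy_pos hG p)
    h3

theorem negEnergy_div_posEnergy_le (hG : G ≠ ⊥) {p : ℝ} (hp : 0 ≤ p) :
    G.negEnergy p / G.posEnergy p ≤
      Fintype.card V * (G.maxAdjEigenvalue / -G.minAdjEigenvalue) ^ p := by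
  have := nonempty_of_ne_bot hG
  have h1 := G.maxAdjEigenvalue_pos hG
  have h2 := neg_pos.2 (G.minAdjEigenvalue_neg hG)
  have h3 := G.neg_minAdjEigenvalue_le_max
  have h4 : G.negEnergy p / G.posEnergy p ≤
      Fintype.card V * (-G.minAdjEigenvalue / G.maxAdjEigenvalue) ^ p := by
    rw [Real.div_rpow h2.le h1.le, ← mul_div_assoc]
    exact div_le_div₀ (by positivity) (G.negEnergy_le hG hp) (by positivity)
      (G.rpow_max_le_posEnergy hG p)
  -- The bases compare through 1, as -λₙ ≤ λ₁.
  refine h4.trans (mul_le_mul_of_nonneg_left (Real.rpow_le_rpow (by positivity) ?_ hp)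
    (Nat.cast_nonneg _))
  exact ((div_le_one h1).2 h3).trans ((one_le_div h2).2 h3)

end SimpleGraph

/-! ### Limits as p tends to infinity -/

/-- A function within a constant factor of `ρ ^ p` has `(p - 1)`-th root tending to `ρ`. -/
theorem Real.tendsto_rpow_one_div_sub_one {f : ℝ → ℝ} {ρ c C : ℝ} (hρ : 0 < ρ) (hc : 0 < c)
    (hC : 0 < C) (hl : ∀ᶠ p in atTop, c * ρ ^ p ≤ f p) (hu : ∀ᶠ p in atTop, f p ≤ C * ρ ^ p) :
    Tendsto (fun p => f p ^ (1 / (p - 1))) atTop (𝓝 ρ) := by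
  have hs : Tendsto (fun p : ℝ => p - 1) atTop atTop := tendsto_atTop_add_const_right _ _ tendsto_id
  have h0 : Tendsto (fun p : ℝ => 1 / (p - 1)) atTop (𝓝 0) := by
    simp only [one_div]
    exact hs.inv_tendsto_atTop
  -- Since a ρ^p = (a ρ) ρ^(p-1), the root equals (a ρ)^(1/(p-1)) ρ, whose first factor tends to 1.
  have key (a : ℝ) (ha : 0 < a) :
      Tendsto (fun p : ℝ => (a * ρ ^ p) ^ (1 / (p - 1))) atTop (𝓝 ρ) := by
    have h1 : Tendsto (fun p : ℝ => (a * ρ) ^ (1 / (p - 1)) * ρ) atTop (𝓝 ρ) := by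
      have := (tendsto_const_nhds (x := a * ρ)).rpow h0 (Or.inl (by positivity))
      simpa using this.mul_const ρ
    refine Tendsto.congr' ?_ h1
    filter_upwards [eventually_gt_atTop 1] with p hp
    have hp' : p - 1 ≠ 0 := by linarith
    have e : ρ ^ p = ρ * ρ ^ (p - 1) := by
      rw [← Real.rpow_one_add' hρ.le (by linarith)]; ring_nf
    rw [e, ← mul_assoc, Real.mul_rpow (x := a * ρ) (by positivity) (by positivity), ← Real.rpow_mul hρ.le,
      mul_one_div_cancel hp', Real.rpow_one]
  refine tendsto_of_tendsto_of_tendsto_of_le_of_le' (key c hc) (key C hC) ?_ ?_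
  · filter_upwards [hl, eventually_gt_atTop 1] with p hp h1
    exact Real.rpow_le_rpow (by positivity) hp (one_div_pos.2 (sub_pos.2 h1)).le
  · filter_upwards [hl, hu, eventually_gt_atTop 1] with p hp hp' h1
    exact Real.rpow_le_rpow ((by positivity : 0 ≤ c * ρ ^ p).trans hp) hp'
      (one_div_pos.2 (sub_pos.2 h1)).le

namespace SimpleGraph

variable {V : Type*} [Fintype V] [DecidableEq V] (G : SimpleGraph V) [DecidableRel G.Adj]

theorem tendsto_energy_ratio (hG : G ≠ ⊥) :
    Tendsto (fun p : ℝ => 1 + (G.posEnergy p / G.negEnergy p) ^ (1 / (p - 1))) atTop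
      (𝓝 (1 + G.maxAdjEigenvalue / (-G.minAdjEigenvalue))) := by
  have := nonempty_of_ne_bot hG
  have hn : (0 : ℝ) < Fintype.card V := mod_cast Fintype.card_pos
  refine (Real.tendsto_rpow_one_div_sub_one (div_pos (G.maxAdjEigenvalue_pos hG)
    (neg_pos.2 (G.minAdjEigenvalue_neg hG))) (inv_pos.2 hn) hn ?_ ?_).const_add 1
  · filter_upwards [eventually_ge_atTop 0] with p hp using G.le_posEnergy_div_negEnergy hG hp
  · filter_upwards [eventually_ge_atTop 0] with p hp using G.posEnergy_div_negEnergy_le hG hp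

theorem tendsto_energyBound (hG : G ≠ ⊥) :
    Tendsto (fun p : ℝ => G.energyBound p) atTop
      (𝓝 (1 + G.maxAdjEigenvalue / (-G.minAdjEigenvalue))) := by
  have := nonempty_of_ne_bot hG
  have hn : (0 : ℝ) < Fintype.card V := mod_cast Fintype.card_pos
  have h := (Real.tendsto_rpow_one_div_sub_one
    (f := fun p => max (G.posEnergy p / G.negEnergy p) (G.negEnergy p / G.posEnergy p))
    (div_pos (G.maxAdjEigenvalue_pos hG)
    (neg_pos.2 (G.minAdjEigenvalue_neg hG))) (inv_pos.2 hn) hn ?_ ?_).const_add 1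
  · refine h.congr' ?_
    filter_upwards [eventually_gt_atTop 1] with p hp
    rw [energyBound, abs_of_pos (sub_pos.2 hp)]
  · filter_upwards [eventually_ge_atTop 0] with p hp
      using (G.le_posEnergy_div_negEnergy hG hp).trans (le_max_left _ _)
  · filter_upwards [eventually_ge_atTop 0] with p hp
      using max_le (G.posEnergy_div_negEnergy_le hG hp) (G.negEnergy_div_posEnergy_le hG hp)

/-! ### The Hoffman bound for the projective rank -/

/-- The lower Rayleigh bound for families of complex matrices indexed by the vertices. -/
theorem min_mul_sum_le_trace {d : ℕ} (Y : V → Matrix (Fin d) (Fin d) ℂ) :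
    G.minAdjEigenvalue * ∑ v, ((Y v).conjTranspose * Y v).trace.re ≤
      ∑ v, ∑ w, if G.Adj v w then ((Y v).conjTranspose * Y w).trace.re else 0 := by
  have htr (v w : V) : ((Y v).conjTranspose * Y w).trace.re =
      ∑ j, ∑ i, ((Y v i j).re * (Y w i j).re + (Y v i j).im * (Y w i j).im) := by
    simp [Matrix.trace, Matrix.mul_apply, Complex.mul_re]
  -- The trace form is a sum over the real and imaginary parts of each entry, so the scalar bound
  -- applies to each separately.
  have h (j i : Fin d) := add_le_add (G.le_adjForm fun v => (Y v i j).re)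
    (G.le_adjForm fun v => (Y v i j).im)
  have hs := Finset.sum_le_sum fun j (_ : j ∈ Finset.univ) =>
    Finset.sum_le_sum fun i (_ : i ∈ Finset.univ) => h j i
  have e1 : ∑ v, ((Y v).conjTranspose * Y v).trace.re =
      ∑ j, ∑ i, (∑ v, (Y v i j).re ^ 2 + ∑ v, (Y v i j).im ^ 2) := by
    simp only [htr, ← sq, ← Finset.sum_add_distrib]
    rw [Finset.sum_comm]
    exact Finset.sum_congr rfl fun j _ => Finset.sum_comm
  have e2 : (∑ v, ∑ w, if G.Adj v w then ((Y v).conjTranspose * Y w).trace.re else 0) =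
      ∑ j, ∑ i, (G.adjForm (fun v => (Y v i j).re) + G.adjForm (fun v => (Y v i j).im)) := by
    have e3 (j i : Fin d) :
        G.adjForm (fun v => (Y v i j).re) + G.adjForm (fun v => (Y v i j).im) =
        ∑ q : V × V, if G.Adj q.1 q.2 then
          (Y q.1 i j).re * (Y q.2 i j).re + (Y q.1 i j).im * (Y q.2 i j).im else 0 := by
      simp only [adjForm, ← Finset.sum_add_distrib, Fintype.sum_prod_type]
      refine Finset.sum_congr rfl fun v _ => Finset.sum_congr rfl fun w _ => ?_
      split_ifs <;> simp
    simp only [e3, htr]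
    rw [← Fintype.sum_prod_type'
      (f := fun v w => if G.Adj v w then ∑ j, ∑ i, ((Y v i j).re * (Y w i j).re +
        (Y v i j).im * (Y w i j).im) else 0)]
    have e4 (j : Fin d) := Finset.sum_comm (s := Finset.univ) (t := Finset.univ)
      (f := fun (i : Fin d) (q : V × V) => if G.Adj q.1 q.2 then
          (Y q.1 i j).re * (Y q.2 i j).re + (Y q.1 i j).im * (Y q.2 i j).im else 0)
    simp only [e4]
    rw [Finset.sum_comm]
    refine Finset.sum_congr rfl fun q _ => ?_
    split_ifs <;> simp
  rw [e1, e2, Finset.mul_sum]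
  simpa only [Finset.mul_sum, mul_add] using hs

/-- The Hoffman bound for a `d/r`-representation. -/
theorem HasProjRep.hoffman_bound (hG : G ≠ ⊥) {d r : ℕ} (hd : 0 < d) (hr : 0 < r)
    (h : G.HasProjRep d r) :
    1 + G.maxAdjEigenvalue / (-G.minAdjEigenvalue) ≤ (d : ℝ) / r := by
  have := nonempty_of_ne_bot hG
  obtain ⟨P, hP, hPP⟩ := h
  obtain ⟨i, hi⟩ := G.exists_adjEigenvalues_eq_max
  obtain ⟨x, hx, hxi⟩ := G.exists_adjForm_eq i
  have hd' : (0 : ℝ) < d := mod_cast hd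
  have hr' : (0 : ℝ) < r := mod_cast hr
  have hneg := neg_pos.2 (G.minAdjEigenvalue_neg hG)
  -- This choice makes P_v - c I traceless, so each pairing loses the same constant c r.
  set c : ℝ := (r : ℝ) / d with hc
  have hcd : c * d = r := by rw [hc]; field_simp
  have hc0 : 0 < c := div_pos hr' hd'
  have htr (v : V) : (P v).trace = r := by
    rw [Matrix.trace_eq_rank_of_isIdempotentElem (hP v).1.isIdempotentElem, (hP v).2]
  have hB (v w : V) : (((x v : ℂ) • (P v - (c : ℂ) • 1)).conjTranspose *
      ((x w : ℂ) • (P w - (c : ℂ) • 1))).trace.re =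
      x v * x w * ((P v * P w).trace.re - c * r) := by
    have hs : (P v).conjTranspose = P v := (hP v).1.isSelfAdjoint
    have : ((x v : ℂ) • (P v - (c : ℂ) • 1)).conjTranspose *
      ((x w : ℂ) • (P w - (c : ℂ) • 1)) = ((x v * x w : ℝ) : ℂ) •
        (P v * P w - (c : ℂ) • P v - (c : ℂ) • P w + ((c * c : ℝ) : ℂ) • 1) := by
      simp only [Matrix.conjTranspose_smul, Matrix.conjTranspose_sub, hs,
        Matrix.conjTranspose_one, Complex.star_def, Complex.conj_ofReal, sub_mul, mul_sub,
        smul_mul_assoc, mul_smul_comm, smul_sub, smul_add, smul_smul, one_mul, mul_one,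
        Complex.ofReal_mul, map_mul]
      module
    rw [this]
    simp only [Matrix.trace_smul, Matrix.trace_add, Matrix.trace_sub, htr, smul_eq_mul,
      Matrix.trace_one, Fintype.card_fin, Complex.re_ofReal_mul, Complex.add_re, Complex.sub_re,
      Complex.natCast_re]
    rw [mul_assoc c, hcd]
    ring
  have hmain := G.min_mul_sum_le_trace fun v => (x v : ℂ) • (P v - (c : ℂ) • 1)
  simp only [hB] at hmain
  have e1 : ∑ v, x v * x v * ((P v * P v).trace.re - c * r) = r - c * r := by
    simp only [(hP _).1.isIdempotentElem.eq, htr, Complex.natCast_re, ← sq, ← Finset.sum_mul, hx,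
      one_mul]
  have e2 : (∑ v, ∑ w, if G.Adj v w then x v * x w * ((P v * P w).trace.re - c * r) else 0) =
      -(c * r) * G.maxAdjEigenvalue := by
    rw [← hi, ← hxi, adjForm, Finset.mul_sum]
    refine Finset.sum_congr rfl fun v _ => ?_
    rw [Finset.mul_sum]
    refine Finset.sum_congr rfl fun w _ => ?_
    split_ifs with hvw
    · rw [hPP v w hvw]; simp; ring
    · simp
  rw [e1, e2] at hmain
  have h3 : c * G.maxAdjEigenvalue ≤ -G.minAdjEigenvalue * (1 - c) := by
    refine le_of_mul_le_mul_right ?_ hr'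
    linarith
  have h4 : (d : ℝ) / r = 1 / c := by rw [hc, one_div_div]
  rw [h4, le_div_iff₀ hc0, add_mul, one_mul, div_mul_eq_mul_div, ← le_sub_iff_add_le',
    div_le_iff₀ hneg]
  linarith

/-- A colouring with `n` colours gives an `n/1`-representation by diagonal matrix units. -/
theorem Colorable.hasProjRep {V : Type*} {G : SimpleGraph V} {n : ℕ} (h : G.Colorable n) :
    G.HasProjRep n 1 := by
  obtain ⟨C⟩ := h
  refine ⟨fun v => Matrix.single (C v) (C v) 1, fun v => ⟨⟨?_, ?_⟩, ?_⟩, fun v w hvw => ?_⟩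
  · simp [IsIdempotentElem]
  · simp [IsSelfAdjoint, Matrix.star_eq_conjTranspose]
  · have h := Matrix.trace_eq_rank_of_isIdempotentElem
      (P := Matrix.single (C v) (C v) (1 : ℂ)) (by simp [IsIdempotentElem])
    rw [Matrix.trace_single_eq_same] at h
    exact_mod_cast h.symm
  · exact Matrix.single_mul_single_of_ne _ _ _ _ (C.valid hvw) _

/-- On a finite vertex set the chromatic number is finite, so `toNat` loses nothing. -/
theorem colorable_toNat_chromaticNumber {V : Type*} [Finite V] (G : SimpleGraph V) :
    G.Colorable G.chromaticNumber.toNat :=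
  G.colorable_chromaticNumber_of_fintype

theorem toNat_chromaticNumber_pos {V : Type*} [Finite V] [Nonempty V] (G : SimpleGraph V) :
    0 < G.chromaticNumber.toNat := by
  obtain ⟨C⟩ := G.colorable_toNat_chromaticNumber
  obtain ⟨v⟩ := ‹Nonempty V›
  exact Fin.pos (C v)

theorem hoffman_bound_le_projectiveRank (hG : G ≠ ⊥) :
    1 + G.maxAdjEigenvalue / (-G.minAdjEigenvalue) ≤ G.projectiveRank := by
  have := nonempty_of_ne_bot hG
  -- An optimal colouring shows that the infimum is over a nonempty set; the real infimum of the
  -- empty set would be 0.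
  refine le_csInf ⟨_, _, 1, G.toNat_chromaticNumber_pos, one_pos,
    G.colorable_toNat_chromaticNumber.hasProjRep, rfl⟩ ?_
  rintro _ ⟨d, r, hd, hr, h, rfl⟩
  exact HasProjRep.hoffman_bound G hG hd hr h

theorem projectiveRank_le_chromaticNumber {V : Type*} [Finite V] [Nonempty V]
    (G : SimpleGraph V) :
    G.projectiveRank ≤ (G.chromaticNumber.toNat : ℝ) := by
  refine csInf_le ⟨0, ?_⟩ ⟨_, 1, G.toNat_chromaticNumber_pos, one_pos,
    G.colorable_toNat_chromaticNumber.hasProjRep, by simp⟩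
  rintro _ ⟨d, r, -, -, -, rfl⟩
  positivity

end SimpleGraph

theorem mainTheorem5 {V : Type*} [Fintype V] [DecidableEq V] (G : SimpleGraph V)
    [DecidableRel G.Adj] (hG : G ≠ ⊥) :
    -- the quantities in the bounds are meaningful
    (∀ p : ℝ, 0 < G.posEnergy p ∧ 0 < G.negEnergy p) ∧
    0 < G.maxAdjEigenvalue ∧ G.minAdjEigenvalue < 0 ∧
    -- the energy bounds converge to the Hoffman bound
    Tendsto (fun p : ℝ => 1 + (G.posEnergy p / G.negEnergy p) ^ (1 / (p - 1))) atTop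
      (𝓝 (1 + G.maxAdjEigenvalue / (-G.minAdjEigenvalue))) ∧
    Tendsto (fun p : ℝ => G.energyBound p) atTop
      (𝓝 (1 + G.maxAdjEigenvalue / (-G.minAdjEigenvalue))) ∧
    -- so a number satisfying the energy bounds satisfies the Hoffman bound
    (∀ x : ℝ, (∃ᶠ p : ℝ in atTop, G.energyBound p ≤ x) →
      1 + G.maxAdjEigenvalue / (-G.minAdjEigenvalue) ≤ x) ∧
    -- the Hoffman bound for the projective rank and the chromatic number
    1 + G.maxAdjEigenvalue / (-G.minAdjEigenvalue) ≤ G.projectiveRank ∧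
    G.projectiveRank ≤ (G.chromaticNumber.toNat : ℝ) ∧
    1 + G.maxAdjEigenvalue / (-G.minAdjEigenvalue) ≤ (G.chromaticNumber.toNat : ℝ) := by
  have := SimpleGraph.nonempty_of_ne_bot hG
  refine ⟨fun p => ⟨G.posEnergy_pos hG p, G.negEnergy_pos hG p⟩, G.maxAdjEigenvalue_pos hG,
    G.minAdjEigenvalue_neg hG, G.tendsto_energy_ratio hG, G.tendsto_energyBound hG,
    fun x hx => le_of_tendsto_of_frequently (G.tendsto_energyBound hG) hx,
    G.hoffman_bound_le_projectiveRank hG, G.projectiveRank_le_chromaticNumber,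
    (G.hoffman_bound_le_projectiveRank hG).trans G.projectiveRank_le_chromaticNumber⟩
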